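/- Let $G=(A,B,E)$ be a bipartite graph. A matching of $G$ is a set $M\subseteq E$ of pairwise vertex-disjoint edges; it is induced if no two distinct edges of $M$ are connected by an edge of $G$. For an integer $k\ge 1$ and $\alpha\in(0,1]$, the graph $G$ is a $(k,\alpha)$-multitasker if every matching $M$ of $G$ with $|M|=k$ contains an induced matching $M'\subseteq M$ with $|M'|\ge \alpha|M|$. Let $\alpha_k(G)$ be the largest $\alpha\in(0,1]$ such that $G$ is a $(k,\alpha)$-multitasker if $G$ has a matching of size $k$, and let $\alpha_k(G)=1$ otherwise. Put $\alpha_{\le k}(G)=\min_{1\le \ell\le k}\alpha_\ell(G)$. Theorem. There are absolute constants $C>0$ and $\varepsilon_0>0$, and thresholds $n_0$ and $d_0$, such that for every integer $n\ge n_0$, every real $d\ge d_0$ and every integer $k\ge 3$ with $k\ge C\cdot n/d^{1+\varepsilon_0}$, every bipartite graph $G$ with $n$ vertices on each side and average degree $d$ satisfies $\alpha_{\le k}(G)<\frac12$. -/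

import Mathlib

namespace Multitasking

universe u

variable {V : Type u}

/-- A matching in `G`: a finite collection of edges of `G` that are pairwise vertex disjoint. -/
def IsMatching (G : SimpleGraph V) (M : Finset (Sym2 V)) : Prop :=
  (∀ e ∈ M, e ∈ G.edgeSet) ∧ ∀ e ∈ M, ∀ f ∈ M, ∀ v : V, v ∈ e → v ∈ f → e = f

/-- A matching is induced in `G` if no two distinct edges of it are connected by an edge of `G`. -/
def IsInducedMatching (G : SimpleGraph V) (M : Finset (Sym2 V)) : Prop :=
  IsMatching G M ∧ ∀ e ∈ M, ∀ f ∈ M, ∀ u ∈ e, ∀ v ∈ f, G.Adj u v → e = f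

/-- `G` is a `(k, α)`-multitasker: every matching of size `k` contains an induced matching with
at least an `α` fraction of its edges. -/
def IsMultitasker (G : SimpleGraph V) (k : ℕ) (α : ℝ) : Prop :=
  ∀ M : Finset (Sym2 V), IsMatching G M → M.card = k →
    ∃ M' : Finset (Sym2 V), M' ⊆ M ∧ IsInducedMatching G M' ∧ α * (M.card : ℝ) ≤ (M'.card : ℝ)

open Classical in
/-- `α_k(G)`: the largest `α ∈ (0, 1]` such that `G` is a `(k, α)`-multitasker if `G` has a matching
of size `k`, and `1` otherwise. The supremum is attained, see `isGreatest_capacity`. -/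
noncomputable def capacity (G : SimpleGraph V) (k : ℕ) : ℝ :=
  if ∃ M : Finset (Sym2 V), IsMatching G M ∧ M.card = k then
    sSup {α : ℝ | α ∈ Set.Ioc (0 : ℝ) 1 ∧ IsMultitasker G k α}
  else 1

/-- `α_{≤ k}(G) = min_{1 ≤ ℓ ≤ k} α_ℓ(G)`, for `k ≥ 1`. -/
noncomputable def capacityLE (G : SimpleGraph V) (k : ℕ) : ℝ :=
  sInf (capacity G '' Set.Icc 1 k)

open Classical in
/-- The average degree of a finite graph. -/
noncomputable def averageDegree [Fintype V] (G : SimpleGraph V) : ℝ :=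
  (∑ v : V, (G.degree v : ℝ)) / (Fintype.card V : ℝ)

/-- The supremum in the definition of `capacity` is a maximum. -/
theorem isGreatest_capacity (G : SimpleGraph V) (k : ℕ) (hk : 1 ≤ k)
    (h : ∃ M : Finset (Sym2 V), IsMatching G M ∧ M.card = k) :
    IsGreatest {α : ℝ | α ∈ Set.Ioc (0 : ℝ) 1 ∧ IsMultitasker G k α} (capacity G k) := by
  classical
  have hk0 : (0 : ℝ) < (k : ℝ) := by exact_mod_cast hk
  set S := {α : ℝ | α ∈ Set.Ioc (0 : ℝ) 1 ∧ IsMultitasker G k α} with hS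
  have hcap : capacity G k = sSup S := by rw [capacity, if_pos h]
  have hbdd : BddAbove S := ⟨1, fun α hα => hα.1.2⟩
  have hmem : (1 / (k : ℝ)) ∈ S := by
    refine ⟨⟨by positivity, ?_⟩, ?_⟩
    · rw [div_le_one hk0]
      exact_mod_cast hk
    · intro M hM hMk
      obtain ⟨e, he⟩ : M.Nonempty := Finset.card_pos.mp (by omega)
      refine ⟨{e}, by simpa using he, ⟨⟨?_, ?_⟩, ?_⟩, ?_⟩
      · intro f hf
        rw [Finset.mem_singleton.mp hf]
        exact hM.1 e he
      · intro f hf g hg _ _ _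
        rw [Finset.mem_singleton.mp hf, Finset.mem_singleton.mp hg]
      · intro f hf g hg _ _ _ _ _
        rw [Finset.mem_singleton.mp hf, Finset.mem_singleton.mp hg]
      · rw [hMk, one_div, inv_mul_cancel₀ hk0.ne']
        simp
  have hpos : 0 < sSup S := lt_of_lt_of_le hmem.1.1 (le_csSup hbdd hmem)
  rw [hcap]
  refine ⟨⟨⟨hpos, csSup_le ⟨_, hmem⟩ fun α hα => hα.1.2⟩, ?_⟩, fun α hα => le_csSup hbdd hα⟩
  intro M hM hMk
  -- choose an induced sub-matching of maximal size
  obtain ⟨N, hN, hmax⟩ := Finset.exists_max_image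
    (M.powerset.filter fun N => IsInducedMatching G N) Finset.card
    ⟨∅, Finset.mem_filter.mpr ⟨by simp, by simp [IsInducedMatching, IsMatching]⟩⟩
  rw [Finset.mem_filter, Finset.mem_powerset] at hN
  refine ⟨N, hN.1, hN.2, ?_⟩
  rw [hMk, ← le_div_iff₀ hk0]
  refine csSup_le ⟨_, hmem⟩ fun α hα => ?_
  obtain ⟨M', h1, h2, h3⟩ := hα.2 M hM hMk
  rw [le_div_iff₀ hk0, ← hMk]
  refine h3.trans ?_
  exact_mod_cast hmax M' (Finset.mem_filter.mpr ⟨Finset.mem_powerset.mpr h1, h2⟩)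

end Multitasking

/-! Pass to an induced subgraph of minimum degree at least d/3. If its girth exceeded k + 1, the
Moore bound (`pow_le_card_of_lt_egirth`) would give more than 2n vertices (`two_mul_lt_pow`), so a
shortest cycle has length g ≤ k + 1, with g even. One edge of this cycle, plus an edge leaving it at
each of the other g - 2 vertices, form g - 1 disjoint edges, cyclically connected along the cycle
(`exists_isMatchingCycle`). An induced submatching is then independent in an odd cycle, so it has
fewer than half of the edges (`IsMatchingCycle.capacity_lt`). -/

namespace SimpleGraph

universe u

variable {V : Type u} {G : SimpleGraph V}

/-! ### Girth and the Moore bound -/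

/-- Two distinct paths with the same ends contain a cycle in their union. -/
theorem Walk.IsPath.eq_of_length_add_lt_egirth {u v : V} {p q : G.Walk u v} (hp : p.IsPath)
    (hq : q.IsPath) (h : ((p.length + q.length : ℕ) : ℕ∞) < G.egirth) : p = q := by
  classical
  -- A cycle in the union of the two paths has at most `p.length + q.length` edges, below the girth.
  -- So the union is a forest, where paths are unique.
  let H : SimpleGraph V := fromEdgeSet {e | e ∈ p.edges ∨ e ∈ q.edges}
  have hmem : ∀ e ∈ G.edgeSet, e ∈ p.edges ∨ e ∈ q.edges → e ∈ H.edgeSet := by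
    intro e he h'
    rw [edgeSet_fromEdgeSet]
    exact ⟨h', G.not_isDiag_of_mem_edgeSet he⟩
  have hpH : ∀ e ∈ p.edges, e ∈ H.edgeSet := fun e he =>
    hmem e (p.edges_subset_edgeSet he) (Or.inl he)
  have hqH : ∀ e ∈ q.edges, e ∈ H.edgeSet := fun e he =>
    hmem e (q.edges_subset_edgeSet he) (Or.inr he)
  have hHG : ∀ e ∈ H.edgeSet, e ∈ p.edges ∨ e ∈ q.edges := by
    intro e he
    rw [edgeSet_fromEdgeSet] at he
    exact he.1
  have hac : H.IsAcyclic := by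
    intro w c hc
    have hcG : ∀ e ∈ c.edges, e ∈ G.edgeSet := fun e he =>
      (hHG e (c.edges_subset_edgeSet he)).elim (fun h => p.edges_subset_edgeSet h)
        (fun h => q.edges_subset_edgeSet h)
    have h1 := egirth_le_length (hc.transfer hcG)
    rw [Walk.length_transfer] at h1
    have h2 : c.edges.toFinset ⊆ p.edges.toFinset ∪ q.edges.toFinset := by
      intro e he
      simp only [List.mem_toFinset, Finset.mem_union] at he ⊢
      exact hHG e (c.edges_subset_edgeSet he)
    have h3 := (Finset.card_le_card h2).trans (Finset.card_union_le _ _)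
    rw [List.toFinset_card_of_nodup hc.edges_nodup, Walk.length_edges] at h3
    have h4 := p.edges.toFinset_card_le
    have h5 := q.edges.toFinset_card_le
    rw [Walk.length_edges] at h4 h5
    have h6 : ((c.length : ℕ) : ℕ∞) ≤ ((p.length + q.length : ℕ) : ℕ∞) := by
      exact_mod_cast h3.trans (add_le_add h4 h5)
    exact absurd (h1.trans h6) (not_le.mpr h)
  have h1 := (hac.subsingleton_path u v).elim ⟨p.transfer H hpH, hp.transfer hpH⟩ ⟨q.transfer H hqH, hq.transfer hqH⟩
  have h2 : (p.transfer H hpH).support = (q.transfer H hqH).support := by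
    rw [Subtype.mk.injEq] at h1
    rw [h1]
  rw [Walk.support_transfer, Walk.support_transfer] at h2
  exact Walk.ext_support h2

/-- The Moore bound: a vertex reaches at least `q ^ r` vertices by paths of length `r`. -/
theorem exists_finset_pow_le_card [Fintype V] [DecidableRel G.Adj] {q : ℕ}
    (hdeg : ∀ v, q + 1 ≤ G.degree v) (v : V) (r : ℕ) (hr : ((2 * r : ℕ) : ℕ∞) < G.egirth) :
    ∃ S : Finset V, q ^ r ≤ S.card ∧ ∀ x ∈ S, ∃ p : G.Walk v x, p.IsPath ∧ p.length = r := by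
  classical
  induction r with
  | zero => exact ⟨{v}, by simp, fun x hx => by
      rw [Finset.mem_singleton] at hx
      subst hx
      exact ⟨Walk.nil, Walk.IsPath.nil, rfl⟩⟩
  | succ r ih =>
    obtain ⟨S, hS, hp⟩ := ih (lt_of_le_of_lt (by exact_mod_cast (by omega)) hr)
    have hp' : ∀ x ∈ S, ∃ z, ∃ p : G.Walk v x, p.IsPath ∧ p.length = r ∧ p.penultimate = z :=
      fun x hx => (hp x hx).elim fun p h => ⟨_, p, h.1, h.2, rfl⟩
    choose! z hz using hp'
    have hext : ∀ x ∈ S, ∀ y ∈ (G.neighborFinset x).erase (z x),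
        ∃ P : G.Walk v y, P.IsPath ∧ P.length = r + 1 ∧ P.penultimate = x := by
      intro x hx y hy
      obtain ⟨p, hpath, hlen, hpen⟩ := hz x hx
      rw [Finset.mem_erase, mem_neighborFinset] at hy
      refine ⟨p.concat hy.2, hpath.concat ?_ hy.2, by simp [hlen], Walk.penultimate_concat _ _⟩
      -- If `y` were on `p`, the tail of `p` from `y` and the edge `yx` would be the same path,
      -- making `y` the penultimate vertex `z x`.
      intro hmem
      apply hy.1
      have hd : (p.dropUntil y hmem).length ≤ r := by
        rw [← hlen]; exact p.length_dropUntil_le_length hmem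
      have h1 : p.dropUntil y hmem = Walk.cons hy.2.symm Walk.nil := by
        refine (hpath.dropUntil hmem).eq_of_length_add_lt_egirth ?_ ?_
        · simp [hy.2.ne']
        · refine lt_of_le_of_lt ?_ hr
          simp only [Walk.length_cons, Walk.length_nil]
          exact_mod_cast (by omega)
      have h2 := p.take_spec hmem
      rw [h1, ← Walk.concat_eq_append] at h2
      rw [← hpen, ← h2, Walk.penultimate_concat]
    refine ⟨S.biUnion fun x => (G.neighborFinset x).erase (z x), ?_, ?_⟩
    · rw [Finset.card_biUnion]
      · calc q ^ (r + 1) = q ^ r * q := pow_succ _ _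
          _ ≤ S.card * q := Nat.mul_le_mul_right _ hS
          _ = ∑ x ∈ S, q := by simp
          _ ≤ _ := Finset.sum_le_sum fun x hx => by
            have h1 := Finset.pred_card_le_card_erase (s := G.neighborFinset x) (a := z x)
            have h2 := hdeg x
            rw [card_neighborFinset_eq_degree] at h1
            omega
      -- A common `y` would end two paths of length `r + 1` from `v`; these coincide, hence so do
      -- their penultimate vertices.
      · intro x hx x' hx' hne
        refine Finset.disjoint_left.mpr ?_
        intro y hy hy'
        obtain ⟨P, hP, hl, he⟩ := hext x hx y hy
        obtain ⟨P', hP', hl', he'⟩ := hext x' hx' y hy'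
        have := hP.eq_of_length_add_lt_egirth hP' (by
          refine lt_of_le_of_lt ?_ hr
          rw [hl, hl']
          exact_mod_cast (by omega))
        exact hne (by rw [← he, ← he', this])
    · intro y hy
      obtain ⟨x, hx, hy⟩ := Finset.mem_biUnion.mp hy
      obtain ⟨P, hP, hl, -⟩ := hext x hx y hy
      exact ⟨P, hP, hl⟩

theorem pow_le_card_of_lt_egirth [Fintype V] [Nonempty V] [DecidableRel G.Adj] {q : ℕ}
    (hdeg : ∀ v, q + 1 ≤ G.degree v) {r : ℕ} (hr : ((2 * r : ℕ) : ℕ∞) < G.egirth) :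
    q ^ r ≤ Fintype.card V := by
  obtain ⟨S, hS, -⟩ := exists_finset_pow_le_card hdeg (Classical.arbitrary V) r hr
  exact hS.trans (Finset.card_le_univ S)

/-! ### Shortest cycles -/

/-- The segment of a cycle between two of its vertices. -/
theorem Walk.IsCycle.exists_isPath_getVert {u : V} {c : G.Walk u u} (hc : c.IsCycle) {i j : ℕ}
    (hij : i ≤ j) (hj : j < c.length) :
    ∃ p : G.Walk (c.getVert i) (c.getVert j), p.IsPath ∧ p.length = j - i ∧
      ∀ x ∈ p.support, x ∈ c.support := by
  have h1 : (c.take j).getVert i = c.getVert i := by rw [Walk.take_getVert, min_eq_right hij]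
  refine ⟨((c.take j).drop i).copy h1 rfl, ?_, ?_, ?_⟩
  · rw [Walk.isPath_copy]
    exact (hc.isPath_take hj).drop i
  · rw [Walk.length_copy, Walk.drop_length, Walk.take_length, min_eq_left hj.le]
  · intro x hx
    rw [Walk.support_copy] at hx
    exact (c.isSubwalk_take j).support_subset (((c.take j).isSubwalk_drop i).support_subset hx)

/-- A shortest cycle has no chords. -/
theorem Walk.IsCycle.eq_add_one_of_adj {u : V} {c : G.Walk u u} (hc : c.IsCycle)
    (hg : G.egirth = c.length) {i j : ℕ} (hij : i < j) (hj : j < c.length)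
    (h : G.Adj (c.getVert i) (c.getVert j)) : j = i + 1 ∨ (i = 0 ∧ j + 1 = c.length) := by
  obtain ⟨p, hp, hl, -⟩ := hc.exists_isPath_getVert hij.le hj
  by_cases h0 : j - i + 1 < c.length
  · left
    have := hp.eq_of_length_add_lt_egirth (q := Walk.cons h Walk.nil) (by simp [h.ne]) (by
      rw [hg, hl]
      simp only [Walk.length_cons, Walk.length_nil]
      exact_mod_cast h0)
    rw [this] at hl
    simp only [Walk.length_cons, Walk.length_nil] at hl
    omega
  · omega

/-- Common neighbours of two close vertices of a shortest cycle are on the cycle. -/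
theorem Walk.IsCycle.mem_support_of_adj_adj {u x : V} {c : G.Walk u u} (hc : c.IsCycle)
    (hg : G.egirth = c.length) {i j : ℕ} (hij : i < j) (hj : j < c.length)
    (hlt : j < i + c.length - 2)
    (hi : G.Adj (c.getVert i) x) (hx : G.Adj (c.getVert j) x) : x ∈ c.support := by
  obtain ⟨p, hp, hl, hs⟩ := hc.exists_isPath_getVert hij.le hj
  have hne : c.getVert i ≠ c.getVert j := fun h => hij.ne
    (hc.getVert_injOn' (by simp only [Set.mem_ofPred_eq]; omega)
      (by simp only [Set.mem_ofPred_eq]; omega) h)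
  have := hp.eq_of_length_add_lt_egirth (q := Walk.cons hi (Walk.cons hx.symm Walk.nil))
    (by simp [hi.ne, hx.ne', hne]) (by
      rw [hg, hl]
      simp only [Walk.length_cons, Walk.length_nil]
      exact_mod_cast (by omega))
  exact hs x (by rw [this]; simp)

/-- Vertices of degree at least three on a shortest cycle have a neighbour outside it. -/
theorem Walk.IsCycle.exists_adj_notMem_support [Fintype V] [DecidableRel G.Adj] {u : V}
    {c : G.Walk u u} (hc : c.IsCycle) (hg : G.egirth = c.length) {i : ℕ} (hi : 0 < i)
    (hic : i < c.length) (hdeg : 3 ≤ G.degree (c.getVert i)) :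
    ∃ x, G.Adj (c.getVert i) x ∧ x ∉ c.support := by
  classical
  by_contra! hcon
  have hsub : G.neighborFinset (c.getVert i) ⊆ {c.getVert (i - 1), c.getVert (i + 1)} := by
    intro x hx
    rw [mem_neighborFinset] at hx
    obtain ⟨j, rfl, hj⟩ := Walk.mem_support_iff_exists_getVert.mp (hcon x hx)
    rw [Finset.mem_insert, Finset.mem_singleton]
    rcases hj.lt_or_eq with hj | rfl
    · rcases lt_trichotomy i j with h | rfl | h
      · rcases hc.eq_add_one_of_adj hg h hj hx with h' | h'
        · rw [h']; exact Or.inr rfl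
        · omega
      · exact (G.loopless.irrefl _ hx).elim
      · rcases hc.eq_add_one_of_adj hg h hic hx.symm with h' | h'
        · rw [h']; exact Or.inl rfl
        · rw [h'.2, h'.1]; right; simp
    · have hend : c.getVert c.length = c.getVert 0 := by simp
      rw [hend] at hx ⊢
      rcases hc.eq_add_one_of_adj hg hi hic hx.symm with h' | h'
      · rw [h']; left; simp
      · rw [h'.2]; right; simp
  have h1 := Finset.card_le_card hsub
  rw [card_neighborFinset_eq_degree] at h1
  have h2 := Finset.card_le_two (a := c.getVert (i - 1)) (b := c.getVert (i + 1))
  omega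

end SimpleGraph

namespace Multitasking

universe u

variable {V : Type u}

/-! ### Odd cycles of matching edges -/

/-- Pairwise disjoint edges `e 0, …, e (m - 1)` of `G` such that cyclically consecutive ones are
connected by an edge of `G`. -/
structure IsMatchingCycle (G : SimpleGraph V) (m : ℕ) (e : ℕ → Sym2 V) : Prop where
  mem_edgeSet : ∀ i < m, e i ∈ G.edgeSet
  disjoint : ∀ i < m, ∀ j < m, ∀ v, v ∈ e i → v ∈ e j → i = j
  connected : ∀ i < m, ∃ u ∈ e i, ∃ v ∈ e ((i + 1) % m), G.Adj u v

theorem IsMatchingCycle.map {W : Type*} {G : SimpleGraph V} {H : SimpleGraph W} {m : ℕ}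
    {e : ℕ → Sym2 V} (h : IsMatchingCycle G m e) (f : G ↪g H) :
    IsMatchingCycle H m fun i => (e i).map f where
  mem_edgeSet i hi := f.toHom.map_mem_edgeSet (h.mem_edgeSet i hi)
  disjoint i hi j hj v hv hv' := by
    obtain ⟨a, ha, rfl⟩ := Sym2.mem_map.mp hv
    obtain ⟨b, hb, hab⟩ := Sym2.mem_map.mp hv'
    rw [f.injective hab] at hb
    exact h.disjoint i hi j hj a ha hb
  connected i hi := by
    obtain ⟨u, hu, v, hv, huv⟩ := h.connected i hi
    exact ⟨f u, Sym2.mem_map.mpr ⟨u, hu, rfl⟩, f v, Sym2.mem_map.mpr ⟨v, hv, rfl⟩,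
      f.map_adj_iff.mpr huv⟩

/-- In an odd cycle of edges fewer than half of the edges form an induced matching. -/
theorem IsMatchingCycle.capacity_lt {G : SimpleGraph V} {m : ℕ} {e : ℕ → Sym2 V}
    (h : IsMatchingCycle G m e) (hm : Odd m) (hm1 : 1 < m) : capacity G m < 1 / 2 := by
  classical
  have hinj : Set.InjOn e (Finset.range m) := by
    intro i hi j hj hij
    rw [Finset.coe_range, Set.mem_Iio] at hi hj
    obtain ⟨u, hu, -⟩ := h.connected i hi
    exact h.disjoint i hi j hj u hu (hij ▸ hu)
  have hM : IsMatching G ((Finset.range m).image e) := by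
    constructor
    · intro f hf
      obtain ⟨i, hi, rfl⟩ := Finset.mem_image.mp hf
      exact h.mem_edgeSet i (Finset.mem_range.mp hi)
    · intro f hf g hg v hv hv'
      obtain ⟨i, hi, rfl⟩ := Finset.mem_image.mp hf
      obtain ⟨j, hj, rfl⟩ := Finset.mem_image.mp hg
      rw [h.disjoint i (Finset.mem_range.mp hi) j (Finset.mem_range.mp hj) v hv hv']
  have hcard : ((Finset.range m).image e).card = m := by
    rw [Finset.card_image_of_injOn hinj, Finset.card_range]
  obtain ⟨M', hsub, hind, hle⟩ :=
    (isGreatest_capacity G m hm1.le ⟨_, hM, hcard⟩).1.2 _ hM hcard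
  rw [hcard] at hle
  let I := (Finset.range m).filter fun i => e i ∈ M'
  have hI : ∀ i ∈ I, i < m ∧ e i ∈ M' := fun i hi => by simpa [I] using hi
  have hM'I : M' = I.image e := by
    ext f
    constructor
    · intro hf
      obtain ⟨i, hi, rfl⟩ := Finset.mem_image.mp (hsub hf)
      exact Finset.mem_image_of_mem _ (Finset.mem_filter.mpr ⟨hi, hf⟩)
    · intro hf
      obtain ⟨i, hi, rfl⟩ := Finset.mem_image.mp hf
      exact (hI i hi).2
  have hM'card : M'.card ≤ I.card := hM'I ▸ Finset.card_image_le
  have hnext : ∀ i < m, (i + 1) % m < m ∧ ((i + 1) % m = i + 1 ∨ i + 1 = m ∧ (i + 1) % m = 0) := by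
    intro i hi
    refine ⟨Nat.mod_lt _ (by omega), ?_⟩
    rcases (show i + 1 ≤ m by omega).lt_or_eq with h' | h'
    · exact Or.inl (Nat.mod_eq_of_lt h')
    · exact Or.inr ⟨h', by rw [h', Nat.mod_self]⟩
  -- `I` and its cyclic shift are disjoint subsets of `range m` of equal size, so `2 * I.card ≤ m`,
  -- strictly since `m` is odd.
  have hdisj : Disjoint I (I.image fun i => (i + 1) % m) := by
    rw [Finset.disjoint_right]
    intro j hj hjI
    obtain ⟨i, hi, rfl⟩ := Finset.mem_image.mp hj
    obtain ⟨u, hu, v, hv, huv⟩ := h.connected i (hI i hi).1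
    have := hind.2 _ (hI i hi).2 _ (hI _ hjI).2 u hu v hv huv
    have := hinj (by simpa using (hI i hi).1) (by simpa using (hI _ hjI).1) this
    have := hnext i (hI i hi).1
    omega
  have hsucc : (I.image fun i => (i + 1) % m).card = I.card := by
    refine Finset.card_image_of_injOn fun i hi j hj hij => ?_
    have h1 := hnext i (hI i hi).1
    have h2 := hnext j (hI j hj).1
    omega
  have htot : (I ∪ I.image fun i => (i + 1) % m).card ≤ (Finset.range m).card := by
    refine Finset.card_le_card fun i hi => ?_
    rw [Finset.mem_range]
    rcases Finset.mem_union.mp hi with hi | hi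
    · exact (hI i hi).1
    · obtain ⟨j, hj, rfl⟩ := Finset.mem_image.mp hi
      exact (hnext j (hI j hj).1).1
  rw [Finset.card_union_of_disjoint hdisj, hsucc, Finset.card_range] at htot
  have hlt : 2 * M'.card < m := by
    obtain ⟨t, rfl⟩ := hm
    omega
  have hlt' : 2 * (M'.card : ℝ) < m := by exact_mod_cast hlt
  have hm0 : (0 : ℝ) < m := by exact_mod_cast (by omega)
  by_contra! hcon
  nlinarith

/-- Supplies the lower bound without which the `sInf` in `capacityLE` could not be compared with its
members. -/
theorem capacity_nonneg (G : SimpleGraph V) (k : ℕ) : 0 ≤ capacity G k := by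
  unfold capacity
  split_ifs
  · exact Real.sSup_nonneg fun α hα => hα.1.1.le
  · exact zero_le_one

theorem capacityLE_le_capacity (G : SimpleGraph V) {m k : ℕ} (hm : 1 ≤ m) (hmk : m ≤ k) :
    capacityLE G k ≤ capacity G m := by
  refine csInf_le ⟨0, ?_⟩ ⟨m, ⟨hm, hmk⟩, rfl⟩
  rintro _ ⟨l, -, rfl⟩
  exact capacity_nonneg G l

/-- A shortest cycle `c` of length `g` yields a cycle of `g - 1` edges: an edge of `c` together with
an edge leaving `c` at each of the remaining vertices. -/
theorem exists_isMatchingCycle [Fintype V] {G : SimpleGraph V} [DecidableRel G.Adj]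
    (hdeg : ∀ v, 3 ≤ G.degree v) {u : V} {c : G.Walk u u} (hc : c.IsCycle)
    (hg : G.egirth = c.length) : ∃ e, IsMatchingCycle G (c.length - 1) e := by
  have hx : ∀ i, 0 < i ∧ i < c.length → ∃ x, G.Adj (c.getVert i) x ∧ x ∉ c.support :=
    fun i hi => hc.exists_adj_notMem_support hg hi.1 hi.2 (hdeg _)
  have : Nonempty V := ⟨u⟩
  choose! x hadj hout using hx
  have h3 := hc.three_le_length
  have hinj : ∀ i < c.length, ∀ j < c.length, c.getVert i = c.getVert j → i = j :=
    fun i hi j hj h => hc.getVert_injOn' (by simp only [Set.mem_ofPred_eq]; omega)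
      (by simp only [Set.mem_ofPred_eq]; omega) h
  have hsupp : ∀ i, c.getVert i ∈ c.support := c.getVert_mem_support
  -- Starting at index 2 keeps `j - i + 2` below the girth, so a shared neighbour would lie on the
  -- cycle.
  have hxinj : ∀ i j, 1 < i → i < j → j < c.length → x i ≠ x j := by
    intro i j hi hij hj h
    have h1 := hadj i ⟨by omega, by omega⟩
    have h2 := hadj j ⟨by omega, hj⟩
    rw [← h] at h2
    exact hout i ⟨by omega, by omega⟩
      (hc.mem_support_of_adj_adj hg hij hj (by omega) h1 h2)
  have hxinj' : ∀ i j, 1 < i → i < c.length → 1 < j → j < c.length → x i = x j → i = j := by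
    intro i j hi hi' hj hj' h
    rcases lt_trichotomy i j with h' | h' | h'
    · exact (hxinj i j hi h' hj' h).elim
    · exact h'
    · exact (hxinj j i hj h' hi' h.symm).elim
  let y : ℕ → V := fun i => if i = 0 then c.getVert 0 else x (i + 1)
  have hy0 : y 0 = c.getVert 0 := rfl
  have hy : ∀ i, i ≠ 0 → y i = x (i + 1) := fun i hi => if_neg hi
  have hcy : ∀ i < c.length - 1, ∀ j < c.length - 1, c.getVert (i + 1) ≠ y j := by
    intro i hi j hj h
    rcases eq_or_ne j 0 with rfl | hj0
    · have := hinj _ (by omega) _ (by omega) h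
      omega
    · rw [hy j hj0] at h
      exact hout (j + 1) ⟨by omega, by omega⟩ (h ▸ hsupp _)
  refine ⟨fun i => s(c.getVert (i + 1), y i), ?_, ?_, ?_⟩
  · intro i hi
    rw [SimpleGraph.mem_edgeSet]
    rcases eq_or_ne i 0 with rfl | hi0
    · exact (c.adj_getVert_succ (by omega)).symm
    · rw [hy i hi0]
      exact hadj _ ⟨by omega, by omega⟩
  · intro i hi j hj v hv hv'
    rw [Sym2.mem_iff] at hv hv'
    rcases hv with rfl | rfl <;> rcases hv' with h | h
    · have := hinj _ (by omega) _ (by omega) h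
      omega
    · exact (hcy i hi j hj h).elim
    · exact (hcy j hj i hi h.symm).elim
    · rcases eq_or_ne i 0 with rfl | hi0 <;> rcases eq_or_ne j 0 with rfl | hj0
      · rfl
      · rw [hy0, hy j hj0] at h
        exact (hout (j + 1) ⟨by omega, by omega⟩ (h ▸ hsupp _)).elim
      · rw [hy0, hy i hi0] at h
        exact (hout (i + 1) ⟨by omega, by omega⟩ (h ▸ hsupp _)).elim
      · rw [hy i hi0, hy j hj0] at h
        have := hxinj' _ _ (by omega) (by omega) (by omega) (by omega) h
        omega
  · intro i hi
    refine ⟨c.getVert (i + 1), Sym2.mem_mk_left _ _, c.getVert (i + 2), ?_,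
      c.adj_getVert_succ (by omega)⟩
    rcases (show i + 1 ≤ c.length - 1 by omega).lt_or_eq with h | h
    · rw [Nat.mod_eq_of_lt h]
      exact Sym2.mem_mk_left _ _
    -- The cyclic order closes up because the last cycle edge ends at `c.getVert 0`, the second end
    -- of edge 0.
    · rw [h, Nat.mod_self, show i + 2 = c.length by omega, hy0, c.getVert_length, c.getVert_zero]
      exact Sym2.mem_mk_right _ _

/-! ### Minimum degree and numerical estimates -/

open Classical in
/-- Deleting vertices of degree less than half of the average degree leaves a nonempty set. -/
theorem exists_nonempty_forall_le_card_filter_adj [Fintype V] (G : SimpleGraph V) {c : ℝ}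
    (hc0 : 0 < c) (hc : c < averageDegree G) :
    ∃ S : Finset V, S.Nonempty ∧ ∀ v ∈ S, c / 2 ≤ ((S.filter (G.Adj v)).card : ℝ) := by
  -- For a maximiser of `f`, erasing `v` changes `f` by `c` minus twice the inner degree of `v`,
  -- which cannot be positive. It is nonempty since `f ∅ = 0 < f univ`.
  let f : Finset V → ℝ := fun S => ∑ v ∈ S, ((S.filter (G.Adj v)).card : ℝ) - c * S.card
  obtain ⟨S, -, hS⟩ := Finset.exists_max_image (Finset.univ : Finset (Finset V)) f ⟨∅, by simp⟩
  have huniv : 0 < f Finset.univ := by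
    have hn : (0 : ℝ) < Fintype.card V := by
      rcases (Nat.cast_nonneg (α := ℝ) (Fintype.card V)).eq_or_lt with h | h
      · rw [averageDegree, ← h, div_zero] at hc
        linarith
      · exact h
    rw [averageDegree, lt_div_iff₀ hn] at hc
    have : ∀ v, Finset.univ.filter (G.Adj v) = G.neighborFinset v := by
      intro v; ext w; simp
    simp only [f, this, SimpleGraph.card_neighborFinset_eq_degree, Finset.card_univ]
    linarith
  refine ⟨S, ?_, fun v hv => ?_⟩
  · rw [Finset.nonempty_iff_ne_empty]
    rintro rfl
    have := hS Finset.univ (Finset.mem_univ _)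
    simp only [f, Finset.sum_empty, Finset.card_empty, Nat.cast_zero, mul_zero, sub_zero] at this
    exact absurd huniv (not_lt.mpr this)
  · have hmax := hS (S.erase v) (Finset.mem_univ _)
    have h1 : ∀ w ∈ S.erase v, ((S.filter (G.Adj w)).card : ℝ) =
        (((S.erase v).filter (G.Adj w)).card : ℝ) + if G.Adj v w then 1 else 0 := by
      intro w _
      rw [Finset.filter_erase]
      split_ifs with h
      · have hmem : v ∈ S.filter (G.Adj w) := Finset.mem_filter.mpr ⟨hv, h.symm⟩
        exact_mod_cast (Finset.card_erase_add_one hmem).symm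
      · rw [Finset.erase_eq_of_notMem fun h' => h (Finset.mem_filter.mp h').2.symm, add_zero]
    have h2 : ∑ w ∈ S.erase v, (if G.Adj v w then (1 : ℝ) else 0) = (S.filter (G.Adj v)).card := by
      rw [Finset.sum_boole, Finset.filter_erase, Finset.erase_eq_of_notMem (by simp)]
    have h3 : ((S.erase v).card : ℝ) = S.card - 1 := by
      rw [Finset.card_erase_of_mem hv, Nat.cast_sub (Finset.card_pos.mpr ⟨v, hv⟩), Nat.cast_one]
    have h4 := Finset.add_sum_erase S (fun w => ((S.filter (G.Adj w)).card : ℝ)) hv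
    rw [Finset.sum_congr rfl h1, Finset.sum_add_distrib, h2] at h4
    simp only [f, h3, ← h4] at hmax
    linarith

/-- A bipartite graph of minimum degree at least three with a short cycle has small capacity. -/
theorem capacityLE_lt_half_of_egirth_le {W : Type*} [Fintype W] {G : SimpleGraph V}
    {H : SimpleGraph W} [DecidableRel H.Adj] (f : H ↪g G) (hbip : H.IsBipartite)
    (hdeg : ∀ v, 3 ≤ H.degree v) {k : ℕ} (hgirth : H.egirth ≤ ((k + 1 : ℕ) : ℕ∞)) :
    capacityLE G k < 1 / 2 := by
  have hac : ¬ H.IsAcyclic := by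
    rw [← SimpleGraph.egirth_eq_top]
    intro h
    rw [h, top_le_iff] at hgirth
    exact ENat.natCast_ne_top _ hgirth
  obtain ⟨u, c, hc, hg⟩ := SimpleGraph.exists_egirth_eq_length.mpr hac
  obtain ⟨e, he⟩ := exists_isMatchingCycle hdeg hc hg
  have hle : c.length ≤ k + 1 := by
    rw [hg] at hgirth
    exact_mod_cast hgirth
  have heven : Even c.length :=
    (((SimpleGraph.recolorOfEquiv H finTwoEquiv hbip.some).even_length_iff_congr c).mpr Iff.rfl)
  have h3 := hc.three_le_length
  refine (capacityLE_le_capacity G (m := c.length - 1) (by omega) (by omega)).trans_lt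
    ((he.map f).capacity_lt ?_ (by omega))
  obtain ⟨t, ht⟩ := heven
  exact ⟨t - 1, by omega⟩

/-- The numerical inequality that contradicts the Moore bound. -/
theorem two_mul_lt_pow {n k q : ℕ} {d : ℝ} (hd : 20000 ≤ d) (hk : 3 ≤ k)
    (hkn : n / d ^ (1 + 1 / 2 : ℝ) ≤ k) (hq : d / 4 ≤ q) : 2 * n < q ^ ((k + 1) / 2) := by
  have hd0 : 0 < d := by linarith
  set s := √d with hs
  have hs2 : s * s = d := Real.mul_self_sqrt hd0.le
  have hs0 : 0 ≤ s := Real.sqrt_nonneg d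
  have hslarge : 128 < s := Real.lt_sqrt_of_sq_lt (by linarith)
  rw [Real.rpow_add hd0, Real.rpow_one, ← Real.sqrt_eq_rpow, ← hs,
    div_le_iff₀ (by positivity)] at hkn
  -- Since `3 ≤ k`, the exponent is at least 2: two factors `q` give `d ^ 2 / 16`, and the rest
  -- absorb the linear growth in `k`. What remains is `128 < √d`.
  obtain ⟨t, ht⟩ : ∃ t, (k + 1) / 2 = t + 2 := ⟨(k + 1) / 2 - 2, by omega⟩
  rw [ht]
  have hkt : (k : ℝ) ≤ 2 * (t + 2) := by exact_mod_cast (show k ≤ 2 * (t + 2) by omega)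
  have h2t : ((t : ℝ) + 2) / 2 ≤ 2 ^ t := by
    have h1 : t + 1 ≤ 2 ^ t := Nat.lt_two_pow_self
    have h2 : (t : ℝ) + 1 ≤ 2 ^ t := by exact_mod_cast h1
    have h3 : (0 : ℝ) ≤ t := Nat.cast_nonneg t
    linarith
  have hqt : (2 : ℝ) ^ t ≤ (q : ℝ) ^ t := pow_le_pow_left₀ (by norm_num) (by linarith) t
  have hq2 : (d / 4) ^ 2 ≤ (q : ℝ) ^ 2 := pow_le_pow_left₀ (by linarith) hq 2
  have ht0 : (0 : ℝ) < t + 2 := by positivity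
  have hreal : 2 * (n : ℝ) < (q : ℝ) ^ (t + 2) := by
    calc 2 * (n : ℝ) ≤ 2 * ((2 * (t + 2)) * (d * s)) := by gcongr; exact hkn.trans (by gcongr)
      _ = (t + 2) * d * (4 * s) := by ring
      _ < (t + 2) * d * (s * s / 32) := by
        apply mul_lt_mul_of_pos_left _ (by positivity)
        nlinarith
      _ = ((t + 2) / 2) * (d / 4) ^ 2 := by rw [hs2]; ring
      _ ≤ (q : ℝ) ^ t * (q : ℝ) ^ 2 := mul_le_mul (h2t.trans hqt) hq2 (by positivity) (by positivity)
      _ = _ := (pow_add _ _ _).symm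
  exact_mod_cast hreal

end Multitasking

/-! ### The main theorem -/

theorem mainTheorem12 :
    ∃ C ε₀ : ℝ, 0 < C ∧ 0 < ε₀ ∧ ∃ (n₀ : ℕ) (d₀ : ℝ),
      ∀ (n : ℕ) (d : ℝ) (k : ℕ), n₀ ≤ n → d₀ ≤ d → 3 ≤ k →
        C * (n : ℝ) / d ^ (1 + ε₀) ≤ (k : ℝ) →
        ∀ (V : Type*) [Fintype V] (G : SimpleGraph V) (A B : Finset V),
          (A : Set V) ∪ (B : Set V) = Set.univ → G.IsBipartiteWith (A : Set V) (B : Set V) →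
          A.card = n → B.card = n → Multitasking.averageDegree G = d →
          Multitasking.capacityLE G k < 1 / 2 := by
  classical
  -- 20000 exceeds 128², as the numerical estimate requires.
  refine ⟨1, 1 / 2, one_pos, by norm_num, 0, 20000, ?_⟩
  intro n d k _ hd hk hkn V _ G A B hAB hbip hA hB havg
  rw [one_mul] at hkn
  have hcard : Fintype.card V ≤ 2 * n := by
    have huniv : (Finset.univ : Finset V) = A ∪ B := by
      rw [← Finset.coe_inj, Finset.coe_union, hAB, Finset.coe_univ]
    rw [← Finset.card_univ, huniv]
    exact (Finset.card_union_le A B).trans (by omega)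
  obtain ⟨S, hSne, hS⟩ := Multitasking.exists_nonempty_forall_le_card_filter_adj G
    -- Strictly below the average degree, yet half of it, `d / 3`, still exceeds `d / 4 + 2 > q +
    -- 1`.
    (c := 2 * d / 3) (by linarith) (by rw [havg]; linarith)
  let H := G.induce (S : Set V)
  let q := ⌈d / 4⌉₊
  have hq : d / 4 ≤ q := Nat.le_ceil _
  have hq' : (q : ℝ) < d / 4 + 1 := Nat.ceil_lt_add_one (by linarith)
  have hdeg : ∀ v, q + 1 ≤ H.degree v := by
    intro v
    have h1 : H.degree v = (S.filter (G.Adj v)).card := by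
      rw [← SimpleGraph.card_neighborFinset_eq_degree,
        ← Finset.card_map (Function.Embedding.subtype _)]
      congr 1
      ext w
      simp [H, and_comm]
    have h2 := hS v v.2
    rw [← h1] at h2
    have h3 : (q : ℝ) + 1 ≤ H.degree v := by linarith
    exact_mod_cast h3
  have hq2 : 2 ≤ q := by
    have : (2 : ℝ) ≤ q := by linarith
    exact_mod_cast this
  have hHbip : H.IsBipartite := hbip.isBipartite.of_hom (SimpleGraph.Embedding.induce _).toHom
  refine Multitasking.capacityLE_lt_half_of_egirth_le (SimpleGraph.Embedding.induce _) hHbip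
    (fun v => le_trans (by omega) (hdeg v)) ?_
  by_contra! hgirth
  have : Nonempty (S : Set V) := hSne.to_subtype
  have h1 := SimpleGraph.pow_le_card_of_lt_egirth hdeg (r := (k + 1) / 2)
    (lt_of_le_of_lt (by exact_mod_cast (by omega)) hgirth)
  have h2 : Fintype.card (S : Set V) ≤ Fintype.card V := Fintype.card_subtype_le _
  have h3 := Multitasking.two_mul_lt_pow hd hk hkn hq
  omega
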